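/- Let $\mathcal H$ be a finite-dimensional complex Hilbert space and write $\mathcal D(\mathcal H^{\otimes n})$ for the set of states (positive semidefinite operators of trace one) on $\mathcal H^{\otimes n}$, identified with density matrices through an orthonormal basis of $\mathcal H$ and the product basis of $\mathcal H^{\otimes n}$. For $\tau,\sigma\in\mathcal D(\mathcal H^{\otimes n})$ let $$\|\tau-\sigma\|_{W_1}=\min\Big\{\sum_{i=1}^n c_i \;:\; c_i\ge 0,\ \tau-\sigma=\sum_{i=1}^n c_i\big(\tau^{(i)}-\eta^{(i)}\big),\ \tau^{(i)},\eta^{(i)}\in\mathcal D(\mathcal H^{\otimes n}),\ \operatorname{Tr}_{A_i}\tau^{(i)}=\operatorname{Tr}_{A_i}\eta^{(i)}\Big\}$$ be the quantum Wasserstein distance of order $1$, where $\operatorname{Tr}_{A_i}$ is the partial trace over the $i$-th tensor factor, and let $S(\sigma)=-\operatorname{Tr}[\sigma\ln\sigma]$ be the von Neumann entropy. Let $\rho\in\mathcal D(\mathcal H)$ and let $(\rho_n)_n$, with $\rho_n\in\mathcal D(\mathcal H^{\otimes n})$, be a Wasserstein almost i.i.d. source along $\rho$, that is, $$\lim_{n\to\infty}\frac1n\big\|\rho_n-\rho^{\otimes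 n}\big\|_{W_1}=0 .$$ Then $$\lim_{n\to\infty}\frac{S(\rho_n)}{n}=S(\rho).$$ -/

import Mathlib

open Filter Topology
open scoped Matrix ComplexOrder

/-- A quantum state (density matrix) on the Hilbert space `ℂ^α` with orthonormal basis indexed by
the finite type `α`: a positive semidefinite complex matrix of trace one. -/
structure DensityMatrix (α : Type*) [Fintype α] where
  /-- The underlying matrix. -/
  mat : Matrix α α ℂ
  posSemidef : mat.PosSemidef
  trace_eq_one : mat.trace = 1

/-- The von Neumann entropy `S(ρ) = -Tr (ρ ln ρ) = -∑ λ ln λ`, the sum running over the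
eigenvalues of `ρ` with multiplicity (natural logarithm, `0 ln 0 = 0`). -/
noncomputable def vonNeumannEntropy {α : Type*} [Fintype α] [DecidableEq α]
    (ρ : DensityMatrix α) : ℝ :=
  ∑ i, Real.negMulLog (ρ.posSemidef.isHermitian.eigenvalues i)

/-! The Hilbert space `(ℂ^d)^{⊗ n}` has the product orthonormal basis indexed by `Fin n → d`, so
that operators on it are matrices indexed by `Fin n → d`. -/

/-- The `n`-fold tensor power of a matrix, acting on `(ℂ^d)^{⊗ n}`. -/
def tensorPow {d : Type*} (n : ℕ) (X : Matrix d d ℂ) : Matrix (Fin n → d) (Fin n → d) ℂ :=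
  Matrix.of fun x y => ∏ i, X (x i) (y i)

theorem tensorPow_mul {d : Type*} [Fintype d] (n : ℕ) (X Y : Matrix d d ℂ) :
    tensorPow n (X * Y) = tensorPow n X * tensorPow n Y := by
  classical
  ext x y
  simp only [tensorPow, Matrix.of_apply, Matrix.mul_apply, Finset.prod_univ_sum,
    Fintype.piFinset_univ, Finset.prod_mul_distrib]

theorem tensorPow_conjTranspose {d : Type*} (n : ℕ) (X : Matrix d d ℂ) :
    tensorPow n Xᴴ = (tensorPow n X)ᴴ := by
  ext x y
  simp [tensorPow, Matrix.conjTranspose_apply]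

theorem tensorPow_trace {d : Type*} [Fintype d] (n : ℕ) (X : Matrix d d ℂ) :
    (tensorPow n X).trace = X.trace ^ n := by
  classical
  have h := (Finset.prod_univ_sum (fun _ : Fin n => (Finset.univ : Finset d))
    (fun _ j => X j j)).symm
  simpa [Matrix.trace, tensorPow] using h

theorem tensorPow_posSemidef {d : Type*} [Fintype d] (n : ℕ) {X : Matrix d d ℂ}
    (hX : X.PosSemidef) : (tensorPow n X).PosSemidef := by
  classical
  obtain ⟨B, rfl⟩ : ∃ B : Matrix d d ℂ, X = Bᴴ * B := by
    open scoped MatrixOrder in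
    exact CStarAlgebra.nonneg_iff_eq_star_mul_self.mp hX.nonneg
  rw [tensorPow_mul, tensorPow_conjTranspose]
  exact Matrix.posSemidef_conjTranspose_mul_self _

/-- The i.i.d. state `ρ^{⊗ n}`. -/
def iidState {d : Type*} [Fintype d] (ρ : DensityMatrix d) (n : ℕ) :
    DensityMatrix (Fin n → d) where
  mat := tensorPow n ρ.mat
  posSemidef := tensorPow_posSemidef n ρ.posSemidef
  trace_eq_one := by rw [tensorPow_trace, ρ.trace_eq_one, one_pow]

/-- The partial trace `Tr_{A_i}` over the `i`-th of the `n` subsystems. The label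
`(Equiv.funSplitAt i d).symm (a, x)` takes the value `a` at `i` and agrees with `x` elsewhere. -/
def partialTrace {d : Type*} [Fintype d] {n : ℕ} (i : Fin n)
    (X : Matrix (Fin n → d) (Fin n → d) ℂ) :
    Matrix ({j : Fin n // j ≠ i} → d) ({j : Fin n // j ≠ i} → d) ℂ :=
  Matrix.of fun x y =>
    ∑ a : d, X ((Equiv.funSplitAt i d).symm (a, x)) ((Equiv.funSplitAt i d).symm (a, y))

/-- `c` is the coefficient vector of a decomposition `ρ - σ = ∑ i, c i • (τ i - η i)` with
`c i ≥ 0`, in which the states `τ i` and `η i` coincide once the `i`-th subsystem is discarded. -/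
def IsW1Decomposition {d : Type*} [Fintype d] {n : ℕ}
    (ρ σ : DensityMatrix (Fin n → d)) (c : Fin n → ℝ) : Prop :=
  (∀ i, 0 ≤ c i) ∧
    ∃ τ η : Fin n → DensityMatrix (Fin n → d),
      (∀ i, partialTrace i (τ i).mat = partialTrace i (η i).mat) ∧
      ρ.mat - σ.mat = ∑ i, c i • ((τ i).mat - (η i).mat)

section W1Feasible
variable {d : Type*} [Fintype d] {n : ℕ}

theorem trace_partialTrace (i : Fin n) (X : Matrix (Fin n → d) (Fin n → d) ℂ) :
    (partialTrace i X).trace = X.trace := by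
  classical
  simp only [Matrix.trace, Matrix.diag, partialTrace, Matrix.of_apply]
  rw [Finset.sum_comm, ← Fintype.sum_prod_type']
  exact (Equiv.funSplitAt i d).symm.sum_comp (fun x => X x x)

/-- Discard the `i`-th subsystem and replace it by the pure state `|a₀⟩⟨a₀|`. -/
def resetMat [DecidableEq d] (a₀ : d) (i : Fin n) (X : Matrix (Fin n → d) (Fin n → d) ℂ) :
    Matrix (Fin n → d) (Fin n → d) ℂ :=
  Matrix.of fun x y => if x i = a₀ ∧ y i = a₀ then
    ∑ b, X (Function.update x i b) (Function.update y i b) else 0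

theorem resetMat_posSemidef [DecidableEq d] (a₀ : d) (i : Fin n)
    {X : Matrix (Fin n → d) (Fin n → d) ℂ} (hX : X.PosSemidef) :
    (resetMat a₀ i X).PosSemidef := by
  have h : (∑ b, X.submatrix (fun x => Function.update x i b)
      (fun x => Function.update x i b)).PosSemidef :=
    Matrix.posSemidef_sum _ fun b _ => hX.submatrix _
  convert h.conjTranspose_mul_mul_same
    (Matrix.diagonal fun x : Fin n → d => if x i = a₀ then (1 : ℂ) else 0) using 1
  ext x y
  rw [Matrix.diagonal_conjTranspose, Matrix.mul_diagonal, Matrix.diagonal_mul, Matrix.sum_apply]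
  by_cases h1 : x i = a₀ <;> by_cases h2 : y i = a₀ <;> simp [resetMat, h1, h2]

theorem partialTrace_resetMat [DecidableEq d] (a₀ : d) (i : Fin n)
    (X : Matrix (Fin n → d) (Fin n → d) ℂ) :
    partialTrace i (resetMat a₀ i X) = partialTrace i X := by
  have hu : ∀ (a b : d) (x : {j : Fin n // j ≠ i} → d),
      Function.update ((Equiv.funSplitAt i d).symm (a, x)) i b
        = (Equiv.funSplitAt i d).symm (b, x) := by
    intro a b x
    ext j
    by_cases hj : j = i
    · subst hj; simp
    · simp [hj]
  ext x y
  simp [partialTrace, resetMat, hu]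

/-- `resetMat` on states. -/
def resetState [DecidableEq d] (a₀ : d) (i : Fin n) (ρ : DensityMatrix (Fin n → d)) :
    DensityMatrix (Fin n → d) where
  mat := resetMat a₀ i ρ.mat
  posSemidef := resetMat_posSemidef a₀ i ρ.posSemidef
  trace_eq_one := by
    rw [← trace_partialTrace i, partialTrace_resetMat, trace_partialTrace, ρ.trace_eq_one]

/-- The equal-weight mixture of two states. -/
noncomputable def midState {α : Type*} [Fintype α] (ρ σ : DensityMatrix α) : DensityMatrix α where
  mat := (1 / 2 : ℂ) • (ρ.mat + σ.mat)
  posSemidef := (ρ.posSemidef.add σ.posSemidef).smul (by positivity)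
  trace_eq_one := by
    rw [Matrix.trace_smul, Matrix.trace_add, ρ.trace_eq_one, σ.trace_eq_one]
    norm_num

/-- Reset the first `k` subsystems. -/
def resetFirst [DecidableEq d] (a₀ : d) (ρ : DensityMatrix (Fin n → d)) :
    ℕ → DensityMatrix (Fin n → d)
  | 0 => ρ
  | k + 1 => if h : k < n then resetState a₀ ⟨k, h⟩ (resetFirst a₀ ρ k) else resetFirst a₀ ρ k

theorem resetFirst_apply [DecidableEq d] (a₀ : d) (ρ : DensityMatrix (Fin n → d)) (k : ℕ)
    (x y : Fin n → d) (j : Fin n) (hj : (j : ℕ) < k) (hxy : ¬ (x j = a₀ ∧ y j = a₀)) :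
    (resetFirst a₀ ρ k).mat x y = 0 := by
  induction k generalizing x y with
  | zero => omega
  | succ k ih =>
    have hk : k < n ∨ ¬ k < n := em _
    rcases hk with hk | hk
    · simp only [resetFirst, hk, dif_pos, resetState, resetMat, Matrix.of_apply]
      by_cases hjk : j = ⟨k, hk⟩
      · subst hjk
        rw [if_neg hxy]
      · split_ifs
        · refine Finset.sum_eq_zero fun b _ => ih _ _ ?_ ?_
          · have : (j : ℕ) ≠ k := fun h => hjk (Fin.ext h)
            omega
          · simpa [Function.update_of_ne hjk] using hxy
        · rfl
    · simp only [resetFirst, hk, dif_neg, not_false_eq_true]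
      exact ih _ _ (by omega) hxy

theorem resetFirst_all [DecidableEq d] (a₀ : d) (ρ σ : DensityMatrix (Fin n → d)) :
    (resetFirst a₀ ρ n).mat = (resetFirst a₀ σ n).mat := by
  have key : ∀ (τ : DensityMatrix (Fin n → d)) (x y : Fin n → d), (resetFirst a₀ τ n).mat x y =
      if x = (fun _ => a₀) ∧ y = (fun _ => a₀) then 1 else 0 := by
    intro τ x y
    split_ifs with h
    · obtain ⟨rfl, rfl⟩ := h
      rw [← (resetFirst a₀ τ n).trace_eq_one, Matrix.trace]
      symm
      refine Finset.sum_eq_single_of_mem _ (Finset.mem_univ _) fun z _ hz => ?_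
      obtain ⟨j, hj⟩ := Function.ne_iff.mp hz
      exact resetFirst_apply a₀ τ n z z j j.2 fun h => hj h.1
    · have : ∃ j, ¬ (x j = a₀ ∧ y j = a₀) := by
        by_contra! hc
        exact h ⟨funext fun j => (hc j).1, funext fun j => (hc j).2⟩
      obtain ⟨j, hj⟩ := this
      exact resetFirst_apply a₀ τ n x y j j.2 hj
  ext x y
  rw [key, key]

/-- Decompositions always exist, so the infimum in `quantumW1` is never over an empty set. -/
theorem exists_isW1Decomposition (ρ σ : DensityMatrix (Fin n → d)) :
    ∃ c, IsW1Decomposition ρ σ c := by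
  classical
  rcases Nat.eq_zero_or_pos n with rfl | hn
  · refine ⟨fun _ => 0, fun _ => le_rfl, fun _ => ρ, fun _ => ρ, fun i => i.elim0, ?_⟩
    ext x y
    have h1 := ρ.trace_eq_one
    have h2 := σ.trace_eq_one
    simp only [Matrix.trace, Fintype.sum_unique, Matrix.diag] at h1 h2
    rw [Subsingleton.elim x default, Subsingleton.elim y default]
    simp [h1, h2]
  obtain ⟨a₀⟩ : Nonempty d := by
    by_contra hd
    rw [not_nonempty_iff] at hd
    have : IsEmpty (Fin n → d) := ⟨fun x => hd.elim (x ⟨0, hn⟩)⟩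
    simpa [Matrix.trace] using ρ.trace_eq_one
  refine ⟨fun _ => 2, fun _ => by norm_num,
    fun i => midState (resetFirst a₀ ρ i) (resetFirst a₀ σ (i + 1)),
    fun i => midState (resetFirst a₀ ρ (i + 1)) (resetFirst a₀ σ i), fun i => ?_, ?_⟩
  · have hs : ∀ τ : DensityMatrix (Fin n → d), partialTrace i (resetFirst a₀ τ (i + 1)).mat =
        partialTrace i (resetFirst a₀ τ i).mat := by
      intro τ
      simp only [resetFirst, i.2, dif_pos, resetState]
      exact partialTrace_resetMat a₀ i _
    have hl : ∀ X Y : Matrix (Fin n → d) (Fin n → d) ℂ,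
        partialTrace i ((1 / 2 : ℂ) • (X + Y)) =
          (1 / 2 : ℂ) • (partialTrace i X + partialTrace i Y) := by
      intro X Y
      ext x y
      simp [partialTrace, Finset.mul_sum, Finset.sum_add_distrib, mul_add]
    simp only [midState, hl, hs]
  · have h := Finset.sum_range_sub'
      (fun k => (resetFirst a₀ ρ k).mat - (resetFirst a₀ σ k).mat) n
    rw [resetFirst_all a₀ ρ σ, sub_self, sub_zero, ← Fin.sum_univ_eq_sum_range
      (fun k => (resetFirst a₀ ρ k).mat - (resetFirst a₀ σ k).mat -
        ((resetFirst a₀ ρ (k + 1)).mat - (resetFirst a₀ σ (k + 1)).mat))] at h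
    simp only [resetFirst.eq_1] at h
    rw [← h]
    refine Finset.sum_congr rfl fun i _ => ?_
    ext x y
    simp only [midState, Matrix.sub_apply, Matrix.smul_apply, Matrix.add_apply,
      Complex.real_smul, smul_eq_mul]
    push_cast
    ring

end W1Feasible

/-- The quantum Wasserstein distance of order one `‖ρ - σ‖_{W₁}`: the least value of `∑ i, c i`
over all decompositions, as an infimum of a nonempty set of nonnegative reals. -/
noncomputable def quantumW1 {d : Type*} [Fintype d] {n : ℕ}
    (ρ σ : DensityMatrix (Fin n → d)) : ℝ :=
  sInf {w : ℝ | ∃ c : Fin n → ℝ, IsW1Decomposition ρ σ c ∧ w = ∑ i, c i}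

/-- `(ρs n)` is a Wasserstein almost i.i.d. source along `ρ`. -/
def IsWassersteinAlmostIID {d : Type*} [Fintype d] (ρ : DensityMatrix d)
    (ρs : (n : ℕ) → DensityMatrix (Fin n → d)) : Prop :=
  Tendsto (fun n : ℕ => 1 / (n : ℝ) * quantumW1 (ρs n) (iidState ρ n)) atTop (𝓝 0)

/-! The limit follows from a continuity bound: for every `0 < ε < 1`, two states on `n` sites
satisfy `|S(ρ) - S(σ)| ≤ -(n+1) log (1-ε) + (log d² - log ε) W₁(ρ, σ)`. Dividing by `n`, letting `n
→ ∞` at fixed `ε` and then `ε → 0` gives the claim, since `S(ρ^{⊗n}) = n S(ρ)`.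

For the bound, compare both states with one reference state `ω` obtained from `τ` by a little
depolarizing noise on every site (`exists_le_depolarize`). Klein's inequality gives `S(σ) ≤ -Tr σ
log ω = -Tr τ log ω + Tr (τ-σ) log ω`. As `ω` dominates `(1-ε)^(n+1) τ`, operator monotonicity of
the logarithm bounds the first term by `S(τ) - (n+1) log (1-ε)` (`neg_trace_mul_log_le`).

For the second term, write `D_i` for depolarization of site `i`. From `ε D_i ω ≤ ω ≤ d² D_i ω`, `log
ω` differs from `log D_i ω` by constants between `log ε` and `log d²`. The operator `log D_i ω` acts
trivially on site `i`, so it cannot distinguish two states that agree off that site. Each unit of W₁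
cost therefore contributes at most `log d² - log ε` (`re_trace_sub_mul_log_le`). -/

open scoped MatrixOrder

set_option linter.unusedSectionVars false

/-! ### Single-site matrix units and depolarizing maps -/

section SiteUnits
variable {d : Type*} [Fintype d] [DecidableEq d] {n : ℕ}

/-- The matrix unit `|b⟩⟨c|` acting on the `i`-th tensor factor. -/
def siteUnit (i : Fin n) (b c : d) : Matrix (Fin n → d) (Fin n → d) ℂ :=
  Matrix.of fun x y => if x i = b ∧ y = Function.update x i c then 1 else 0

theorem siteUnit_mul_apply (i : Fin n) (b c : d) (X : Matrix (Fin n → d) (Fin n → d) ℂ)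
    (x y : Fin n → d) :
    (siteUnit i b c * X) x y = if x i = b then X (Function.update x i c) y else 0 := by
  rw [Matrix.mul_apply]
  by_cases h : x i = b <;> simp [siteUnit, h]

theorem siteUnit_conjTranspose (i : Fin n) (b c : d) :
    (siteUnit i b c)ᴴ = siteUnit i c b := by
  ext x y
  have h : (y i = b ∧ x = Function.update y i c) ↔ (x i = c ∧ y = Function.update x i b) := by
    constructor
    · rintro ⟨rfl, rfl⟩; simp
    · rintro ⟨rfl, rfl⟩; simp
  simp only [Matrix.conjTranspose_apply, siteUnit, Matrix.of_apply, h]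
  split_ifs <;> simp

theorem mul_siteUnit_apply (i : Fin n) (b c : d) (X : Matrix (Fin n → d) (Fin n → d) ℂ)
    (x y : Fin n → d) :
    (X * siteUnit i b c) x y = if y i = c then X x (Function.update y i b) else 0 := by
  have h := congrArg star (siteUnit_mul_apply i c b Xᴴ y x)
  rw [← siteUnit_conjTranspose, ← Matrix.conjTranspose_mul, Matrix.conjTranspose_apply,
    star_star] at h
  rw [h]
  split_ifs <;> simp

theorem siteUnit_mul_siteUnit (i : Fin n) (a b c e : d) :
    siteUnit i a b * siteUnit i c e = if b = c then siteUnit i a e else 0 := by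
  ext x y
  rw [siteUnit_mul_apply]
  by_cases h : b = c <;> by_cases h' : x i = a <;> simp [siteUnit, h, h']

theorem sum_siteUnit_self (i : Fin n) : ∑ a : d, siteUnit i a a = 1 := by
  ext x y
  rw [Matrix.sum_apply, Finset.sum_eq_single (x i)]
  · simp [siteUnit, Matrix.one_apply, eq_comm]
  · intro b _ hb
    simp [siteUnit, hb.symm]
  · simp

theorem siteUnit_commute {i j : Fin n} (hij : i ≠ j) (a b c e : d) :
    siteUnit i a b * siteUnit j c e = siteUnit j c e * siteUnit i a b := by
  ext x y
  rw [siteUnit_mul_apply, siteUnit_mul_apply]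
  by_cases h : x i = a <;> by_cases h' : x j = c <;>
    simp [siteUnit, h, h', Function.update_of_ne hij, Function.update_of_ne hij.symm,
      Function.update_comm hij]

/-- The completely depolarizing map on the `i`-th tensor factor: discard this factor and replace it
by the maximally mixed state. -/
noncomputable def depolarize (i : Fin n) (X : Matrix (Fin n → d) (Fin n → d) ℂ) :
    Matrix (Fin n → d) (Fin n → d) ℂ :=
  (Fintype.card d : ℝ)⁻¹ • ∑ b : d, ∑ c : d, siteUnit i b c * X * siteUnit i c b

theorem depolarize_add (i : Fin n) (X Y : Matrix (Fin n → d) (Fin n → d) ℂ) :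
    depolarize i (X + Y) = depolarize i X + depolarize i Y := by
  simp [depolarize, mul_add, add_mul, Finset.sum_add_distrib]

theorem depolarize_smul (i : Fin n) (r : ℝ) (X : Matrix (Fin n → d) (Fin n → d) ℂ) :
    depolarize i (r • X) = r • depolarize i X := by
  simp [depolarize, Finset.smul_sum, smul_comm r]

theorem depolarize_sub (i : Fin n) (X Y : Matrix (Fin n → d) (Fin n → d) ℂ) :
    depolarize i (X - Y) = depolarize i X - depolarize i Y := by
  simp [depolarize, mul_sub, sub_mul, Finset.sum_sub_distrib, smul_sub]

theorem depolarize_nonneg (i : Fin n) {X : Matrix (Fin n → d) (Fin n → d) ℂ} (hX : 0 ≤ X) :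
    0 ≤ depolarize i X := by
  refine smul_nonneg (by positivity) (Finset.sum_nonneg fun b _ => Finset.sum_nonneg fun c _ => ?_)
  rw [Matrix.nonneg_iff_posSemidef] at hX ⊢
  rw [← siteUnit_conjTranspose i b c]
  exact hX.mul_mul_conjTranspose_same _

theorem depolarize_mono (i : Fin n) {X Y : Matrix (Fin n → d) (Fin n → d) ℂ} (h : X ≤ Y) :
    depolarize i X ≤ depolarize i Y := by
  rw [← sub_nonneg, ← depolarize_sub]
  exact depolarize_nonneg i (sub_nonneg.mpr h)

theorem siteUnit_mul_depolarize (i : Fin n) (p q : d) (X : Matrix (Fin n → d) (Fin n → d) ℂ) :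
    siteUnit i p q * depolarize i X =
      (Fintype.card d : ℝ)⁻¹ • ∑ c : d, siteUnit i p c * X * siteUnit i c q := by
  rw [depolarize, mul_smul_comm, Finset.mul_sum, Finset.sum_eq_single q]
  · simp only [Finset.mul_sum, ← mul_assoc, siteUnit_mul_siteUnit, if_true]
  · intro b _ hb
    simp [Finset.mul_sum, ← mul_assoc, siteUnit_mul_siteUnit, hb.symm]
  · simp

theorem depolarize_mul_siteUnit (i : Fin n) (p q : d) (X : Matrix (Fin n → d) (Fin n → d) ℂ) :
    depolarize i X * siteUnit i p q =
      (Fintype.card d : ℝ)⁻¹ • ∑ c : d, siteUnit i p c * X * siteUnit i c q := by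
  rw [depolarize, smul_mul_assoc, Finset.sum_mul, Finset.sum_eq_single p]
  · simp only [Finset.sum_mul, mul_assoc, siteUnit_mul_siteUnit, if_true]
  · intro b _ hb
    simp [Finset.sum_mul, mul_assoc, siteUnit_mul_siteUnit, hb]
  · simp

theorem depolarize_eq_self [Nonempty d] (i : Fin n) {L : Matrix (Fin n → d) (Fin n → d) ℂ}
    (hL : ∀ p q, Commute (siteUnit i p q) L) : depolarize i L = L := by
  have h : ∀ b c : d, siteUnit i b c * L * siteUnit i c b = siteUnit i b b * L := by
    intro b c
    rw [mul_assoc, ← (hL c b).eq, ← mul_assoc, siteUnit_mul_siteUnit, if_pos rfl]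
  simp only [depolarize, h, Finset.sum_const, Finset.card_univ]
  rw [← Finset.smul_sum, ← Finset.sum_mul, sum_siteUnit_self, one_mul,
    ← Nat.cast_smul_eq_nsmul ℝ, smul_smul, inv_mul_cancel₀ (by positivity), one_smul]

/-- Multiplication by a matrix unit on either side collapses the double sum to the same single sum.
-/
theorem commute_siteUnit_depolarize (i : Fin n) (p q : d)
    (X : Matrix (Fin n → d) (Fin n → d) ℂ) : Commute (siteUnit i p q) (depolarize i X) := by
  rw [commute_iff_eq, siteUnit_mul_depolarize, depolarize_mul_siteUnit]

theorem depolarize_depolarize [Nonempty d] (i : Fin n) (X : Matrix (Fin n → d) (Fin n → d) ℂ) :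
    depolarize i (depolarize i X) = depolarize i X :=
  depolarize_eq_self i fun p q => commute_siteUnit_depolarize i p q X

theorem sum_comm_four {ι M : Type*} [Fintype ι] [AddCommMonoid M] (F : ι → ι → ι → ι → M) :
    ∑ x, ∑ y, ∑ c, ∑ e, F x y c e = ∑ c, ∑ e, ∑ x, ∑ y, F x y c e := by
  rw [← Fintype.sum_prod_type' fun x y => ∑ c, ∑ e, F x y c e,
    ← Fintype.sum_prod_type' fun c e => ∑ x, ∑ y, F x y c e]
  calc _ = ∑ p : ι × ι, ∑ q : ι × ι, F p.1 p.2 q.1 q.2 :=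
        Finset.sum_congr rfl fun _ _ => (Fintype.sum_prod_type _).symm
    _ = ∑ q : ι × ι, ∑ p : ι × ι, F p.1 p.2 q.1 q.2 := Finset.sum_comm
    _ = _ := Finset.sum_congr rfl fun _ _ => Fintype.sum_prod_type _

theorem depolarize_comm (i j : Fin n) (X : Matrix (Fin n → d) (Fin n → d) ℂ) :
    depolarize i (depolarize j X) = depolarize j (depolarize i X) := by
  rcases eq_or_ne i j with rfl | hij
  · rfl
  have h : ∀ a b c e : d, siteUnit i a b * (siteUnit j c e * X * siteUnit j e c) * siteUnit i b a =
      siteUnit j c e * (siteUnit i a b * X * siteUnit i b a) * siteUnit j e c := by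
    intro a b c e
    calc _ = (siteUnit i a b * siteUnit j c e) * X * (siteUnit j e c * siteUnit i b a) := by
          simp only [mul_assoc]
      _ = _ := by
          rw [siteUnit_commute hij, ← siteUnit_commute hij b a e c]
          simp only [mul_assoc]
  simp only [depolarize, mul_smul_comm, smul_mul_assoc, Finset.mul_sum, Finset.sum_mul,
    ← Finset.smul_sum, h]
  rw [sum_comm_four]

/-- An observable trivial on site `i` does not see what happens there: each unit slides past `L`,
and cyclicity of the trace recombines the units into the identity. -/
theorem trace_depolarize_mul [Nonempty d] (i : Fin n) (Z : Matrix (Fin n → d) (Fin n → d) ℂ)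
    {L : Matrix (Fin n → d) (Fin n → d) ℂ} (hL : ∀ p q, Commute (siteUnit i p q) L) :
    (depolarize i Z * L).trace = (Z * L).trace := by
  have h : ∀ b c : d, (siteUnit i b c * Z * siteUnit i c b * L).trace =
      (Z * L * siteUnit i c c).trace := by
    intro b c
    rw [mul_assoc, (hL c b).eq, mul_assoc, Matrix.trace_mul_comm]
    simp only [mul_assoc, siteUnit_mul_siteUnit, if_true]
  simp only [depolarize, smul_mul_assoc, Finset.sum_mul, Matrix.trace_smul, Matrix.trace_sum, h,
    Finset.sum_const, Finset.card_univ]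
  rw [← Matrix.trace_sum, ← Finset.mul_sum, sum_siteUnit_self, mul_one,
    ← Nat.cast_smul_eq_nsmul ℝ, smul_smul, inv_mul_cancel₀ (by positivity), one_smul]

theorem trace_depolarize [Nonempty d] (i : Fin n) (X : Matrix (Fin n → d) (Fin n → d) ℂ) :
    (depolarize i X).trace = X.trace := by
  simpa using trace_depolarize_mul i X (L := 1) fun p q => Commute.one_right _

/-- The pinching inequality costs one factor `d`. The pinching consists of the diagonal terms of the
positive double sum defining `depolarize`, whose normalization costs the other. -/
theorem le_depolarize [Nonempty d] (i : Fin n) {X : Matrix (Fin n → d) (Fin n → d) ℂ}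
    (hX : 0 ≤ X) : X ≤ ((Fintype.card d : ℝ) ^ 2) • depolarize i X := by
  have hpos : ∀ b c : d, 0 ≤ siteUnit i b c * X * siteUnit i c b := by
    intro b c
    rw [Matrix.nonneg_iff_posSemidef] at hX ⊢
    rw [← siteUnit_conjTranspose i b c]
    exact hX.mul_mul_conjTranspose_same _
  have h1 : 0 ≤ ∑ a : d, ∑ b : d, (siteUnit i a a - siteUnit i b b) * X *
      (siteUnit i a a - siteUnit i b b) := by
    refine Finset.sum_nonneg fun a _ => Finset.sum_nonneg fun b _ => ?_
    rw [Matrix.nonneg_iff_posSemidef] at hX ⊢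
    have := hX.mul_mul_conjTranspose_same (siteUnit i a a - siteUnit i b b)
    rwa [Matrix.conjTranspose_sub, siteUnit_conjTranspose, siteUnit_conjTranspose] at this
  -- Expanding the squares leaves `2 (d · pinching - X)`, because the cross terms sum to `X`.
  have h2 : ∑ a : d, ∑ b : d, (siteUnit i a a - siteUnit i b b) * X *
      (siteUnit i a a - siteUnit i b b) =
      (2 : ℝ) • ((Fintype.card d : ℝ) • ∑ a : d, siteUnit i a a * X * siteUnit i a a - X) := by
    have e1 : ∑ a : d, ∑ b : d, siteUnit i a a * X * siteUnit i b b = X := by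
      simp only [← Finset.mul_sum, sum_siteUnit_self, mul_one, ← Finset.sum_mul, one_mul]
    have e2 : ∑ a : d, ∑ b : d, siteUnit i b b * X * siteUnit i a a = X := by
      rw [Finset.sum_comm, e1]
    simp only [sub_mul, mul_sub, Finset.sum_sub_distrib, e1, e2, Finset.sum_const,
      Finset.card_univ, ← Finset.smul_sum]
    rw [Nat.cast_smul_eq_nsmul ℝ, two_smul]
    abel
  have h3 : X ≤ (Fintype.card d : ℝ) • ∑ a : d, siteUnit i a a * X * siteUnit i a a := by
    rw [h2] at h1
    have := smul_nonneg (by norm_num : (0 : ℝ) ≤ 2⁻¹) h1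
    rw [smul_smul] at this
    norm_num at this
    exact this
  refine h3.trans ?_
  rw [depolarize, smul_smul, sq, mul_assoc, mul_inv_cancel₀ (by positivity), mul_one]
  refine smul_le_smul_of_nonneg_left (Finset.sum_le_sum fun a _ => ?_) (by positivity)
  exact Finset.single_le_sum (f := fun c => siteUnit i a c * X * siteUnit i c a)
    (fun c _ => hpos a c) (Finset.mem_univ a)

/-- This links the matrix-unit form of the map to the partial traces constrained in the definition
of W₁. -/
theorem depolarize_apply (i : Fin n) (X : Matrix (Fin n → d) (Fin n → d) ℂ) (x y : Fin n → d) :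
    depolarize i X x y = (Fintype.card d : ℝ)⁻¹ • if x i = y i then
      partialTrace i X (fun j => x j) (fun j => y j) else 0 := by
  have hu : ∀ (z : Fin n → d) (a : d),
      (Equiv.funSplitAt i d).symm (a, fun j => z j) = Function.update z i a := by
    intro z a
    ext j
    by_cases hj : j = i
    · subst hj; simp
    · simp [hj]
  rw [depolarize, Matrix.smul_apply, Matrix.sum_apply]
  congr 1
  simp only [Matrix.sum_apply, mul_siteUnit_apply, siteUnit_mul_apply, partialTrace,
    Matrix.of_apply, hu]
  rw [Finset.sum_eq_single (y i)]
  · simp only [if_true]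
    split_ifs <;> simp
  · intro b _ hb
    simp [hb.symm]
  · simp

theorem depolarize_eq_of_partialTrace_eq (i : Fin n) {X Y : Matrix (Fin n → d) (Fin n → d) ℂ}
    (h : partialTrace i X = partialTrace i Y) : depolarize i X = depolarize i Y := by
  ext x y
  rw [depolarize_apply, depolarize_apply, h]

/-- Partially depolarizing every tensor factor turns `X` into an operator which dominates a multiple
of each of its own depolarizations. -/
theorem exists_le_depolarize [Nonempty d] {ε : ℝ} (h0 : 0 ≤ ε) (h1 : ε ≤ 1)
    {X : Matrix (Fin n → d) (Fin n → d) ℂ} (hX : 0 ≤ X) :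
    ∃ ω : Matrix (Fin n → d) (Fin n → d) ℂ, ω.trace = X.trace ∧ (1 - ε) ^ n • X ≤ ω ∧
      ∀ i, ε • depolarize i ω ≤ ω := by
  suffices H : ∀ s : Finset (Fin n), ∃ ω : Matrix (Fin n → d) (Fin n → d) ℂ, 0 ≤ ω ∧
      ω.trace = X.trace ∧ (1 - ε) ^ s.card • X ≤ ω ∧ ∀ i ∈ s, ε • depolarize i ω ≤ ω by
    obtain ⟨ω, -, ht, hle, hd⟩ := H Finset.univ
    exact ⟨ω, ht, by simpa using hle, fun i => hd i (Finset.mem_univ i)⟩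
  intro s
  have h1' : 0 ≤ 1 - ε := sub_nonneg.mpr h1
  induction s using Finset.induction_on with
  | empty => exact ⟨X, hX, rfl, by simp, by simp⟩
  | insert j s hj ih =>
    obtain ⟨ω, hω, ht, hle, hd⟩ := ih
    have hD := depolarize_nonneg j hω
    -- Noise is added one site at a time. Site `j` gains its inequality because `D_j` is idempotent;
    -- earlier sites keep theirs because the maps commute and preserve order.
    refine ⟨(1 - ε) • ω + ε • depolarize j ω,
      add_nonneg (smul_nonneg h1' hω) (smul_nonneg h0 hD), ?_, ?_, ?_⟩
    · rw [Matrix.trace_add, Matrix.trace_smul, Matrix.trace_smul, trace_depolarize, ht, ← add_smul]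
      simp
    · rw [Finset.card_insert_of_notMem hj, pow_succ', mul_smul]
      exact le_add_of_le_of_nonneg (smul_le_smul_of_nonneg_left hle h1') (smul_nonneg h0 hD)
    · intro i hi
      rw [depolarize_add, depolarize_smul, depolarize_smul]
      rcases Finset.mem_insert.mp hi with rfl | hi
      · rw [depolarize_depolarize, ← add_smul, sub_add_cancel, one_smul]
        exact le_add_of_nonneg_left (smul_nonneg h1' hω)
      · rw [smul_add, depolarize_comm, smul_comm ε (1 - ε), ← depolarize_smul j]
        exact add_le_add (smul_le_smul_of_nonneg_left (hd i hi) h1')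
          (smul_le_smul_of_nonneg_left (depolarize_mono j (hd i hi)) h0)

end SiteUnits

open scoped Matrix.Norms.L2Operator

/-! ### Entropy inequalities against a reference operator -/

section Entropy
variable {α : Type*} [Fintype α] [DecidableEq α]

/-- The expectation value of `M` in the `k`-th eigenvector of the Hermitian matrix `A`. -/
noncomputable def eigenExpectation {A : Matrix α α ℂ} (hA : A.IsHermitian) (M : Matrix α α ℂ)
    (k : α) : ℝ :=
  ((star (hA.eigenvectorUnitary : Matrix α α ℂ) * M * hA.eigenvectorUnitary) k k).re

variable {A : Matrix α α ℂ} (hA : A.IsHermitian)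

theorem eigenExpectation_add (M N : Matrix α α ℂ) (k : α) :
    eigenExpectation hA (M + N) k = eigenExpectation hA M k + eigenExpectation hA N k := by
  simp [eigenExpectation, mul_add, add_mul]

theorem eigenExpectation_sub (M N : Matrix α α ℂ) (k : α) :
    eigenExpectation hA (M - N) k = eigenExpectation hA M k - eigenExpectation hA N k := by
  simp [eigenExpectation, mul_sub, sub_mul]

theorem eigenExpectation_smul (r : ℝ) (M : Matrix α α ℂ) (k : α) :
    eigenExpectation hA (r • M) k = r * eigenExpectation hA M k := by
  simp [eigenExpectation]

theorem eigenExpectation_one (k : α) : eigenExpectation hA 1 k = 1 := by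
  simp [eigenExpectation]

theorem eigenExpectation_nonneg {M : Matrix α α ℂ} (hM : 0 ≤ M) (k : α) :
    0 ≤ eigenExpectation hA M k := by
  rw [Matrix.nonneg_iff_posSemidef] at hM
  exact (Complex.nonneg_iff.mp
    (hM.conjTranspose_mul_mul_same (hA.eigenvectorUnitary : Matrix α α ℂ)).diag_nonneg).1

theorem eigenExpectation_mono {M N : Matrix α α ℂ} (h : M ≤ N) (k : α) :
    eigenExpectation hA M k ≤ eigenExpectation hA N k := by
  rw [← sub_nonneg, ← eigenExpectation_sub]
  exact eigenExpectation_nonneg hA (sub_nonneg.mpr h) k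

theorem sum_eigenExpectation (M : Matrix α α ℂ) : ∑ k, eigenExpectation hA M k = M.trace.re := by
  have h : (star (hA.eigenvectorUnitary : Matrix α α ℂ) * M * hA.eigenvectorUnitary).trace =
      M.trace := by
    rw [Matrix.trace_mul_comm, ← mul_assoc]
    simp
  rw [← h, Matrix.trace, Complex.re_sum]
  rfl

theorem eigenExpectation_cfc (f : ℝ → ℝ) (k : α) :
    eigenExpectation hA (cfc f A) k = f (hA.eigenvalues k) := by
  rw [hA.cfc_eq, Matrix.IsHermitian.cfc, Unitary.conjStarAlgAut_apply, eigenExpectation]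
  simp [← mul_assoc]
  simp [mul_assoc]

theorem trace_mul_eq_sum_eigenExpectation (M : Matrix α α ℂ) :
    (A * M).trace.re = ∑ k, hA.eigenvalues k * eigenExpectation hA M k := by
  have h : (A * M).trace = (Matrix.diagonal (fun k => (hA.eigenvalues k : ℂ)) *
      (star (hA.eigenvectorUnitary : Matrix α α ℂ) * M * hA.eigenvectorUnitary)).trace := by
    conv_lhs => rw [hA.spectral_theorem, Unitary.conjStarAlgAut_apply]
    rw [mul_assoc, mul_assoc, Matrix.trace_mul_comm]
    simp only [mul_assoc]
    rfl
  rw [h, Matrix.trace, Complex.re_sum]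
  refine Finset.sum_congr rfl fun k _ => ?_
  rw [Matrix.diag_apply, Matrix.diagonal_mul, Complex.re_ofReal_mul]
  rfl

theorem trace_mul_mono (hA : 0 ≤ A) {M N : Matrix α α ℂ} (h : M ≤ N) :
    (A * M).trace.re ≤ (A * N).trace.re := by
  rw [Matrix.nonneg_iff_posSemidef] at hA
  rw [trace_mul_eq_sum_eigenExpectation hA.isHermitian,
    trace_mul_eq_sum_eigenExpectation hA.isHermitian]
  exact Finset.sum_le_sum fun k _ => mul_le_mul_of_nonneg_left
    (eigenExpectation_mono _ h k) (hA.eigenvalues_nonneg k)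

theorem DensityMatrix.sum_eigenvalues (σ : DensityMatrix α) :
    ∑ k, σ.posSemidef.isHermitian.eigenvalues k = 1 := by
  have h : σ.mat.trace = ∑ k, (σ.posSemidef.isHermitian.eigenvalues k : ℂ) :=
    σ.posSemidef.isHermitian.trace_eq_sum_eigenvalues
  rw [σ.trace_eq_one] at h
  exact_mod_cast h.symm

/-- The concave logarithm lies below its tangent line at `c`, and functional calculus preserves
this. -/
theorem log_le_affine {ω : Matrix α α ℂ} (hω : IsStrictlyPositive ω) {c : ℝ} (hc : 0 < c) :
    CFC.log ω ≤ c⁻¹ • ω + (Real.log c - 1) • (1 : Matrix α α ℂ) := by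
  have hsa : IsSelfAdjoint ω := hω.isSelfAdjoint
  have h : c⁻¹ • ω + (Real.log c - 1) • (1 : Matrix α α ℂ) =
      cfc (fun t : ℝ => c⁻¹ * t + (Real.log c - 1)) ω := by
    rw [cfc_add_const _ _ ω, cfc_const_mul_id _ ω, Algebra.algebraMap_eq_smul_one]
  rw [h, CFC.log]
  have hspec : ∀ t ∈ spectrum ℝ ω, 0 < t := fun t ht => hω.spectrum_pos ht
  refine cfc_mono (fun t ht => ?_) (Real.continuousOn_log.mono fun t ht => (hspec t ht).ne')
  have ht := hspec t ht
  have := Real.log_le_sub_one_of_pos (div_pos ht hc)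
  rw [Real.log_div ht.ne' hc.ne', div_eq_inv_mul] at this
  linarith

/-- Klein's inequality. -/
theorem vonNeumannEntropy_le_neg_trace_mul_log (σ : DensityMatrix α) {ω : Matrix α α ℂ}
    (hω : IsStrictlyPositive ω) (ht : ω.trace = 1) :
    vonNeumannEntropy σ ≤ -(σ.mat * CFC.log ω).trace.re := by
  set hσ := σ.posSemidef.isHermitian
  rw [trace_mul_eq_sum_eigenExpectation hσ, ← Finset.sum_neg_distrib]
  -- The tangent point is the eigenvalue itself. The two linear terms cancel in the sum, both totals
  -- being one.
  have hk : ∀ k, Real.negMulLog (hσ.eigenvalues k) + hσ.eigenvalues k - eigenExpectation hσ ω k ≤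
      -(hσ.eigenvalues k * eigenExpectation hσ (CFC.log ω) k) := by
    intro k
    have hq := eigenExpectation_nonneg hσ hω.nonneg k
    have hnn : 0 ≤ hσ.eigenvalues k := σ.posSemidef.eigenvalues_nonneg k
    rcases hnn.eq_or_lt with h0 | hpos
    · simp [← h0, hq]
    · have h := eigenExpectation_mono hσ (log_le_affine hω hpos) k
      rw [eigenExpectation_add, eigenExpectation_smul, eigenExpectation_smul,
        eigenExpectation_one] at h
      have h' := mul_le_mul_of_nonneg_left h hpos.le
      rw [mul_add, ← mul_assoc, mul_inv_cancel₀ hpos.ne'] at h'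
      simp only [Real.negMulLog]
      nlinarith
  refine le_trans (le_of_eq ?_) (Finset.sum_le_sum fun k _ => hk k)
  rw [Finset.sum_sub_distrib, Finset.sum_add_distrib, σ.sum_eigenvalues, sum_eigenExpectation, ht]
  simp [vonNeumannEntropy]

/-- After operator monotonicity of the logarithm everything commutes with `τ`, and `log (a λ + δ) ≥
log a + log λ` at each positive eigenvalue `λ`. The shift `δ` only secures invertibility and leaves
no trace in the bound. -/
theorem neg_trace_mul_log_le (τ : DensityMatrix α) {ω : Matrix α α ℂ} {a δ : ℝ} (ha : 0 < a)
    (hδ : 0 < δ) (hω : a • τ.mat + δ • (1 : Matrix α α ℂ) ≤ ω) :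
    -(τ.mat * CFC.log ω).trace.re ≤ vonNeumannEntropy τ - Real.log a := by
  set hτ := τ.posSemidef.isHermitian
  have hsa : IsSelfAdjoint τ.mat := hτ
  have hcont : ContinuousOn Real.log ((fun t : ℝ => a * t + δ) '' spectrum ℝ τ.mat) := by
    refine Real.continuousOn_log.mono ?_
    rintro _ ⟨t, ht, rfl⟩
    rw [hτ.spectrum_real_eq_range_eigenvalues] at ht
    obtain ⟨k, rfl⟩ := ht
    have := mul_nonneg ha.le (τ.posSemidef.eigenvalues_nonneg k)
    exact (add_pos_of_nonneg_of_pos this hδ).ne'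
  have hcfc : a • τ.mat + δ • (1 : Matrix α α ℂ) = cfc (fun t : ℝ => a * t + δ) τ.mat := by
    rw [cfc_add_const _ _ τ.mat, cfc_const_mul_id _ τ.mat, Algebra.algebraMap_eq_smul_one]
  have hlog : CFC.log (a • τ.mat + δ • (1 : Matrix α α ℂ)) =
      cfc (fun t : ℝ => Real.log (a * t + δ)) τ.mat := by
    rw [hcfc, CFC.log, ← cfc_comp' Real.log (fun t : ℝ => a * t + δ) τ.mat hcont]
  have hpos : IsStrictlyPositive (a • τ.mat + δ • (1 : Matrix α α ℂ)) := by
    rw [Matrix.isStrictlyPositive_iff_posDef]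
    exact Matrix.PosDef.posSemidef_add (τ.posSemidef.smul ha.le) (Matrix.PosDef.one.smul hδ)
  have h1 := trace_mul_mono τ.posSemidef.nonneg (CFC.log_le_log hω hpos)
  rw [hlog, trace_mul_eq_sum_eigenExpectation hτ] at h1
  refine (neg_le_neg h1).trans ?_
  have h2 : vonNeumannEntropy τ - Real.log a = ∑ k, (Real.negMulLog (hτ.eigenvalues k) -
      hτ.eigenvalues k * Real.log a) := by
    rw [Finset.sum_sub_distrib, ← Finset.sum_mul, τ.sum_eigenvalues, one_mul, vonNeumannEntropy]
  rw [h2, ← Finset.sum_neg_distrib]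
  refine Finset.sum_le_sum fun k _ => ?_
  rw [eigenExpectation_cfc]
  have hnn : 0 ≤ hτ.eigenvalues k := τ.posSemidef.eigenvalues_nonneg k
  rcases hnn.eq_or_lt with h0 | hk
  · simp [← h0]
  · have h3 : Real.log (a * hτ.eigenvalues k) ≤ Real.log (a * hτ.eigenvalues k + δ) :=
      Real.log_le_log (mul_pos ha hk) (by linarith)
    rw [Real.log_mul ha.ne' hk.ne'] at h3
    have := mul_le_mul_of_nonneg_left h3 hk.le
    simp only [Real.negMulLog]
    linarith

/-- The entropy of a state diagonalized by a unitary. -/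
theorem vonNeumannEntropy_eq_of_conj_diagonal (σ : DensityMatrix α) {U : Matrix α α ℂ} {p : α → ℝ}
    (hU : Uᴴ * U = 1) (h : σ.mat = U * Matrix.diagonal (fun k => (p k : ℂ)) * Uᴴ) :
    vonNeumannEntropy σ = ∑ k, Real.negMulLog (p k) := by
  -- The eigenvalues agree with `p` only up to order, so they are compared as multisets of roots.
  have h1 : σ.mat.charpoly.roots = Finset.univ.val.map fun k => (p k : ℂ) := by
    rw [h, Matrix.charpoly_mul_comm, ← mul_assoc, hU, one_mul, Matrix.charpoly_diagonal,
      ← Polynomial.roots_multiset_prod_X_sub_C (Finset.univ.val.map fun k => (p k : ℂ)),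
      Multiset.map_map]
    rfl
  rw [σ.posSemidef.isHermitian.roots_charpoly_eq_eigenvalues] at h1
  have h2 := congrArg (fun s => (s.map fun z : ℂ => Real.negMulLog z.re).sum) h1
  simpa [vonNeumannEntropy] using h2

end Entropy

/-! ### Additivity of entropy for i.i.d. states -/

theorem vonNeumannEntropy_iidState {d : Type*} [Fintype d] [DecidableEq d] (ρ : DensityMatrix d)
    (n : ℕ) : vonNeumannEntropy (iidState ρ n) = n * vonNeumannEntropy ρ := by
  set hρ := ρ.posSemidef.isHermitian
  set U : Matrix d d ℂ := ↑hρ.eigenvectorUnitary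
  set p := hρ.eigenvalues
  have hU : Uᴴ * U = 1 := Unitary.coe_star_mul_self hρ.eigenvectorUnitary
  have hdiag : ∀ q : d → ℝ, tensorPow n (Matrix.diagonal fun k => (q k : ℂ)) =
      Matrix.diagonal fun x : Fin n → d => ((∏ i, q (x i) : ℝ) : ℂ) := by
    intro q
    ext x y
    by_cases hxy : x = y
    · subst hxy; simp [tensorPow]
    · obtain ⟨i, hi⟩ := Function.ne_iff.mp hxy
      rw [Matrix.diagonal_apply_ne _ hxy]
      exact Finset.prod_eq_zero (Finset.mem_univ i) (Matrix.diagonal_apply_ne _ hi)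
  have hone : tensorPow n (1 : Matrix d d ℂ) = 1 := by
    have := hdiag fun _ => 1
    simpa using this
  have hmat : (iidState ρ n).mat = tensorPow n U *
      Matrix.diagonal (fun x : Fin n → d => ((∏ i, p (x i) : ℝ) : ℂ)) * (tensorPow n U)ᴴ := by
    rw [← hdiag, ← tensorPow_conjTranspose, ← tensorPow_mul, ← tensorPow_mul]
    change tensorPow n ρ.mat = _
    conv_lhs => rw [hρ.spectral_theorem, Unitary.conjStarAlgAut_apply]
    rfl
  rw [vonNeumannEntropy_eq_of_conj_diagonal _
    (by rw [← tensorPow_conjTranspose, ← tensorPow_mul, hU, hone]) hmat]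
  clear hmat hdiag hone
  have hp : ∑ k, p k = 1 := ρ.sum_eigenvalues
  induction n with
  | zero => simp
  | succ n ih =>
    have hp' : ∑ x : Fin n → d, ∏ i, p (x i) = 1 := by
      have := Finset.prod_univ_sum (fun _ : Fin n => (Finset.univ : Finset d)) (fun _ k => p k)
      simp only [Fintype.piFinset_univ, hp, Finset.prod_const_one] at this
      exact this.symm
    -- Splitting off the first site, the Leibniz rule for `negMulLog` and total mass one separate
    -- the two entropies.
    rw [← (Fin.consEquiv fun _ : Fin (n + 1) => d).sum_comp, Fintype.sum_prod_type]
    simp only [Fin.consEquiv_apply, Fin.prod_univ_succ, Fin.cons_zero, Fin.cons_succ,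
      Real.negMulLog_mul, Finset.sum_add_distrib, ← Finset.mul_sum, ← Finset.sum_mul]
    rw [ih, hp', hp]
    push_cast
    simp only [vonNeumannEntropy]
    ring

/-! ### Entropy continuity in W₁ -/

section Continuity
variable {d : Type*} [Fintype d] [DecidableEq d] {n : ℕ}

theorem re_trace_mul_add_smul_one {α : Type*} [Fintype α] [DecidableEq α] (τ : DensityMatrix α)
    (r : ℝ) (M : Matrix α α ℂ) :
    (τ.mat * (r • (1 : Matrix α α ℂ) + M)).trace.re = r + (τ.mat * M).trace.re := by
  rw [mul_add, Matrix.trace_add, mul_smul_comm, mul_one, Matrix.trace_smul, τ.trace_eq_one]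
  simp

theorem log_smul_eq {α : Type*} [Fintype α] [DecidableEq α] {N : Matrix α α ℂ}
    (hN : IsStrictlyPositive N) {r : ℝ} (hr : 0 < r) :
    CFC.log (r • N) = Real.log r • (1 : Matrix α α ℂ) + CFC.log N := by
  rw [CFC.log_smul' N hr, Algebra.algebraMap_eq_smul_one]

/-- The upper comparison with `D_i ω` is used for `τ` and the lower one for `η`; their `log D_i ω`
terms coincide and cancel. -/
theorem re_trace_sub_mul_log_le [Nonempty d] (i : Fin n)
    {ω : Matrix (Fin n → d) (Fin n → d) ℂ} (hω : IsStrictlyPositive ω) {ε : ℝ} (hε : 0 < ε)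
    (h : ε • depolarize i ω ≤ ω) {τ η : DensityMatrix (Fin n → d)}
    (hτη : partialTrace i τ.mat = partialTrace i η.mat) :
    ((τ.mat - η.mat) * CFC.log ω).trace.re ≤
      Real.log ((Fintype.card d : ℝ) ^ 2) - Real.log ε := by
  have hd : (0 : ℝ) < (Fintype.card d : ℝ) ^ 2 := by positivity
  have hle := le_depolarize i hω.nonneg
  have hN : IsStrictlyPositive (depolarize i ω) := by
    have h1 := (hω.of_le hle).smul (inv_pos.mpr hd)
    rwa [smul_smul, inv_mul_cancel₀ hd.ne', one_smul] at h1
  have h1 := trace_mul_mono τ.posSemidef.nonneg (CFC.log_le_log hle hω)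
  have h2 := trace_mul_mono η.posSemidef.nonneg (CFC.log_le_log h (hN.smul hε))
  rw [log_smul_eq hN hd, re_trace_mul_add_smul_one] at h1
  rw [log_smul_eq hN hε, re_trace_mul_add_smul_one] at h2
  have hcomm : ∀ p q, Commute (siteUnit i p q) (CFC.log (depolarize i ω)) := fun p q =>
    ((commute_siteUnit_depolarize i p q ω).symm.cfc_real Real.log).symm
  have h3 := trace_depolarize_mul i (τ.mat - η.mat) hcomm
  rw [depolarize_sub, depolarize_eq_of_partialTrace_eq i hτη, sub_self, zero_mul,
    Matrix.trace_zero, sub_mul, Matrix.trace_sub] at h3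
  have h4 := congrArg Complex.re h3
  rw [Complex.zero_re, Complex.sub_re] at h4
  rw [sub_mul, Matrix.trace_sub, Complex.sub_re]
  linarith

theorem vonNeumannEntropy_sub_le [Nonempty d] {ε : ℝ} (h0 : 0 < ε) (h1 : ε < 1)
    {τ σ : DensityMatrix (Fin n → d)} {c : Fin n → ℝ} (hc : IsW1Decomposition τ σ c) :
    vonNeumannEntropy σ - vonNeumannEntropy τ ≤ -((n + 1) * Real.log (1 - ε)) +
      (Real.log ((Fintype.card d : ℝ) ^ 2) - Real.log ε) * ∑ i, c i := by
  obtain ⟨hc0, α, β, hαβ, hdec⟩ := hc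
  have h1' : 0 < 1 - ε := sub_pos.mpr h1
  obtain ⟨m, hm⟩ : ∃ m : ℝ, m = (Fintype.card (Fin n → d) : ℝ) := ⟨_, rfl⟩
  have hm0 : 0 < m := by rw [hm]; positivity
  -- Mixing in the maximally mixed state makes the reference invertible; it supplies the extra
  -- factor `1 - ε` behind the exponent `n + 1`.
  set X : Matrix (Fin n → d) (Fin n → d) ℂ := (1 - ε) • τ.mat + (ε * m⁻¹) • 1 with hX
  have hX0 : 0 ≤ X := add_nonneg (smul_nonneg h1'.le τ.posSemidef.nonneg)
    (smul_nonneg (by positivity) Matrix.PosSemidef.one.nonneg)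
  have hXt : X.trace = 1 := by
    rw [hX, Matrix.trace_add, Matrix.trace_smul, Matrix.trace_smul, τ.trace_eq_one,
      Matrix.trace_one]
    have : (m : ℂ) ≠ 0 := by exact_mod_cast hm0.ne'
    have hm' : ((Fintype.card (Fin n → d) : ℕ) : ℂ) = (m : ℂ) := by simp [hm]
    rw [hm', Complex.real_smul, Complex.real_smul]
    push_cast
    field_simp
    ring
  obtain ⟨ω, hωt, hωle, hωd⟩ := exists_le_depolarize h0.le h1.le hX0
  rw [hXt] at hωt
  rw [hX, smul_add, smul_smul, smul_smul, ← pow_succ] at hωle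
  have ha : 0 < (1 - ε) ^ (n + 1) := by positivity
  have hδ : 0 < (1 - ε) ^ n * (ε * m⁻¹) := by positivity
  have hω : IsStrictlyPositive ω := by
    refine IsStrictlyPositive.of_le ?_ hωle
    rw [Matrix.isStrictlyPositive_iff_posDef]
    exact Matrix.PosDef.posSemidef_add (τ.posSemidef.smul ha.le) (Matrix.PosDef.one.smul hδ)
  have hS := vonNeumannEntropy_le_neg_trace_mul_log σ hω hωt
  have hT := neg_trace_mul_log_le τ ha hδ hωle
  rw [Real.log_pow] at hT
  have hW : ((τ.mat - σ.mat) * CFC.log ω).trace.re ≤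
      (Real.log ((Fintype.card d : ℝ) ^ 2) - Real.log ε) * ∑ i, c i := by
    rw [hdec, Finset.sum_mul, Matrix.trace_sum, Complex.re_sum, Finset.mul_sum]
    refine Finset.sum_le_sum fun i _ => ?_
    rw [smul_mul_assoc, Matrix.trace_smul, Complex.smul_re, smul_eq_mul, mul_comm]
    exact mul_le_mul_of_nonneg_right (re_trace_sub_mul_log_le i hω h0 (hωd i) (hαβ i)) (hc0 i)
  rw [sub_mul, Matrix.trace_sub, Complex.sub_re] at hW
  push_cast at hT
  linarith

theorem IsW1Decomposition.symm {ρ σ : DensityMatrix (Fin n → d)} {c : Fin n → ℝ}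
    (h : IsW1Decomposition ρ σ c) : IsW1Decomposition σ ρ c := by
  obtain ⟨hc, τ, η, hτη, hdec⟩ := h
  refine ⟨hc, η, τ, fun i => (hτη i).symm, ?_⟩
  rw [← neg_sub, hdec, ← Finset.sum_neg_distrib]
  exact Finset.sum_congr rfl fun i _ => by rw [← smul_neg, neg_sub]

/-- Continuity of the von Neumann entropy with respect to the quantum `W₁` distance. -/
theorem abs_vonNeumannEntropy_sub_le [Nonempty d] {ε : ℝ} (h0 : 0 < ε) (h1 : ε < 1)
    (ρ σ : DensityMatrix (Fin n → d)) :
    |vonNeumannEntropy ρ - vonNeumannEntropy σ| ≤ -((n + 1) * Real.log (1 - ε)) +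
      (Real.log ((Fintype.card d : ℝ) ^ 2) - Real.log ε) * quantumW1 ρ σ := by
  have hC : 0 < Real.log ((Fintype.card d : ℝ) ^ 2) - Real.log ε := by
    have hd : (1 : ℝ) ≤ (Fintype.card d : ℝ) ^ 2 :=
      one_le_pow₀ (by exact_mod_cast Nat.one_le_iff_ne_zero.mpr Fintype.card_ne_zero)
    linarith [Real.log_nonneg hd, Real.log_neg h0 h1]
  -- Solving for the distance reduces the claim to a lower bound on every feasible cost, so no
  -- minimizer is needed.
  rw [← sub_le_iff_le_add', ← div_le_iff₀' hC]
  obtain ⟨c, hc⟩ := exists_isW1Decomposition ρ σ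
  refine le_csInf ⟨_, c, hc, rfl⟩ ?_
  rintro _ ⟨c, hc, rfl⟩
  rw [div_le_iff₀' hC, sub_le_iff_le_add', abs_le']
  exact ⟨vonNeumannEntropy_sub_le h0 h1 hc.symm, by
    rw [neg_sub]; exact vonNeumannEntropy_sub_le h0 h1 hc⟩

end Continuity

/-! ### Passage to the limit -/

theorem mainTheorem6 {d : Type*} [Fintype d] [DecidableEq d] (ρ : DensityMatrix d)
    (ρs : (n : ℕ) → DensityMatrix (Fin n → d)) (hρs : IsWassersteinAlmostIID ρ ρs) :
    Tendsto (fun n : ℕ => vonNeumannEntropy (ρs n) / (n : ℝ)) atTop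
      (𝓝 (vonNeumannEntropy ρ)) := by
  have : Nonempty d := by
    by_contra hd
    rw [not_nonempty_iff] at hd
    simpa [Matrix.trace] using ρ.trace_eq_one
  -- The factor 2 absorbs `(n + 1) / n ≤ 2`, valid once `n ≥ 1`.
  have hlim : Tendsto (fun ε : ℝ => -(2 * Real.log (1 - ε))) (𝓝[>] 0) (𝓝 0) := by
    have hcont : ContinuousAt (fun ε : ℝ => -(2 * Real.log (1 - ε))) 0 := by
      fun_prop (disch := norm_num)
    simpa using hcont.tendsto.mono_left nhdsWithin_le_nhds
  rw [Metric.tendsto_atTop]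
  intro r hr
  -- The noise level is fixed before `n`, so the possibly large constant `C` does not grow with `n`.
  obtain ⟨ε, hεr, h0, h1⟩ := ((hlim.eventually_lt_const (half_pos hr)).and
    (Ioo_mem_nhdsGT (zero_lt_one' ℝ))).exists
  set C := Real.log ((Fintype.card d : ℝ) ^ 2) - Real.log ε
  have hW : Tendsto (fun n : ℕ => C * (1 / (n : ℝ) * quantumW1 (ρs n) (iidState ρ n))) atTop
      (𝓝 0) := by simpa using Tendsto.const_mul C hρs
  obtain ⟨N, hN⟩ := eventually_atTop.mp (hW.eventually_lt_const (half_pos hr))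
  refine ⟨max N 1, fun n hn => ?_⟩
  have hn1 : (1 : ℝ) ≤ n := by exact_mod_cast (le_max_right N 1).trans hn
  have hn0 : (0 : ℝ) < n := by linarith
  have hb := abs_vonNeumannEntropy_sub_le h0 h1 (ρs n) (iidState ρ n)
  rw [vonNeumannEntropy_iidState] at hb
  have hNn := hN n ((le_max_left N 1).trans hn)
  rw [Real.dist_eq, div_sub' hn0.ne', abs_div, abs_of_pos hn0, div_lt_iff₀ hn0]
  have hl : Real.log (1 - ε) ≤ 0 := Real.log_nonpos (by linarith) (by linarith)
  have hNn' : C * quantumW1 (ρs n) (iidState ρ n) < r / 2 * n := by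
    rw [← div_lt_iff₀ hn0]
    calc _ = C * (1 / (n : ℝ) * quantumW1 (ρs n) (iidState ρ n)) := by ring
      _ < _ := hNn
  nlinarith
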